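/- Let $T=(V,E)$ be a perfect binary tree with root $r$ and height $h\ge 4$ (a finite rooted tree in which every non-leaf node has exactly two children and all leaves are at graph distance $h$ from $r$), with unit edge weights, $n=|V|$ nodes, Laplacian matrix $L$ and graph distance $d$. For a set $S\subseteq V$ of noise-free leaders let $L_{ff}$ be the principal submatrix of $L$ indexed by the followers $V\setminus S$. The leaders sit at the external signal $0$, and the follower states obey $\dot{\mathbf x}_f=-L_{ff}\mathbf x_f+\mathbf d_f$, where $\mathbf d_f$ is a vector of independent zero-mean unit-variance white noises; that is, started from $\mathbf x_f(0)$, the state $\mathbf x_f(t)$ is Gaussian with mean $e^{-tL_{ff}}\mathbf x_f(0)$ and covariance matrix $\int_0^t e^{-sL_{ff}}(e^{-sL_{ff}})^{\mathsf T}\,ds$. The coherence of $S$ is the total steady-state variance $$R_{NF}(S)=\lim_{t\to\infty}\sum_{i\in V\setminus S}\mathbb E\big[x_i(t)^2\big]\in[0,\infty]$$ (the limit being the same for all initial states), and $S$ is called optimal if $|S|\le 2$ and $R_{NF}(S)\le R_{NF}(S')$ for all $S'\subseteq V$ with $|S'|\le 2$. Then optimal sets exist. Every set $\{x,y\}$ with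 $d_{xy}=4$ and $d_{xr}=d_{yr}=2$ is optimal. If $h\ge 5$, these are the only optimal sets; if $h=4$, the optimal sets are exactly these together with the sets $\{x,y\}$ with $d_{xy}=3$, $d_{xr}=1$, $d_{yr}=2$. Every optimal set $S$ has coherence $$R_{NF}(S)=\frac{n+1}{2}\left(\log_2(n+1)-\frac{25}{8}\right)+\frac72 .$$ -/

import Mathlib

open scoped ENNReal Matrix Topology

namespace LeaderSelection

section Dynamics

variable {V : Type*} [Fintype V] [DecidableEq V]

/-- The followers, i.e. the nodes outside the leader set `S`. -/
abbrev Follower (S : Finset V) : Type _ := {i : V // i ∉ S}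

/-- The principal submatrix `L_ff` of the Laplacian `L` of the graph `G` (unit edge weights)
with rows and columns indexed by the followers. -/
def followerLaplacian (G : SimpleGraph V) [DecidableRel G.Adj] (S : Finset V) :
    Matrix (Follower S) (Follower S) ℝ :=
  (G.lapMatrix ℝ).submatrix Subtype.val Subtype.val

/-- The flow `exp (-t L_ff)` of the noiseless follower dynamics `x' = - L_ff x`. -/
noncomputable def flow (G : SimpleGraph V) [DecidableRel G.Adj] (S : Finset V) (t : ℝ) :
    Matrix (Follower S) (Follower S) ℝ :=
  NormedSpace.exp (-(t • followerLaplacian G S))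

/-- The covariance matrix `∫₀ᵗ exp (-s L_ff) exp (-s L_ff)ᵀ ds` of the follower states at time `t`
(the integral is taken entrywise). -/
noncomputable def followerCov (G : SimpleGraph V) [DecidableRel G.Adj] (S : Finset V) (t : ℝ) :
    Matrix (Follower S) (Follower S) ℝ :=
  Matrix.of fun i j => ∫ s in (0 : ℝ)..t, (flow G S s * (flow G S s)ᵀ) i j

/-- The law at time `t` of the follower states under the dynamics with noise-free leaders,
`dx = - L_ff x dt + dW`, `x 0 = x₀`, where the leaders sit at the external signal `0` and `W` is a
standard Brownian motion with one independent coordinate per follower.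
The solution is the Ornstein-Uhlenbeck process, whose law at time `t` is Gaussian with
mean `exp (-t L_ff) x₀` and covariance matrix `followerCov G S t`. -/
noncomputable def followerLaw (G : SimpleGraph V) [DecidableRel G.Adj] (S : Finset V)
    (x₀ : Follower S → ℝ) (t : ℝ) : MeasureTheory.Measure (EuclideanSpace ℝ (Follower S)) :=
  ProbabilityTheory.multivariateGaussian (WithLp.toLp 2 (flow G S t *ᵥ x₀)) (followerCov G S t)

/-- The total variance `∑ i, E [x_i(t) ^ 2]` of the followers about the external signal `0`. -/
noncomputable def totalVariance (G : SimpleGraph V) [DecidableRel G.Adj] (S : Finset V)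
    (x₀ : Follower S → ℝ) (t : ℝ) : ℝ≥0∞ :=
  ∑ i : Follower S, ∫⁻ x, ENNReal.ofReal (x i ^ 2) ∂(followerLaw G S x₀ t)

/-- The noise-free coherence `R_NF(S)` is `R`: from every initial state the total variance of the
followers tends to `R` as time tends to infinity. -/
def HasCoherence (G : SimpleGraph V) [DecidableRel G.Adj] (S : Finset V) (R : ℝ≥0∞) : Prop :=
  ∀ x₀ : Follower S → ℝ, Filter.Tendsto (totalVariance G S x₀) Filter.atTop (𝓝 R)

/-- `S` solves the noise-free `k`-leader selection problem: it minimizes the coherence among all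
leader sets with at most `k` elements. -/
def IsOptimalLeaderSet (G : SimpleGraph V) [DecidableRel G.Adj] (k : ℕ) (S : Finset V) : Prop :=
  S.card ≤ k ∧ ∃ R : ℝ≥0∞, HasCoherence G S R ∧
    ∀ S' : Finset V, S'.card ≤ k → ∃ R' : ℝ≥0∞, HasCoherence G S' R' ∧ R ≤ R'

end Dynamics

section Trees

variable {V : Type*}

/-- The children of `v` in the graph `T` rooted at `r`: the neighbours one level further down. -/
def children (T : SimpleGraph V) (r v : V) : Set V :=
  {w | T.Adj v w ∧ T.dist r w = T.dist r v + 1}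

/-- `T` with root `r` is a perfect `M`-ary tree of height `h`: every node with a child has exactly
`M` children, and every leaf is at level `h`. -/
structure IsPerfectTree (T : SimpleGraph V) (r : V) (M h : ℕ) : Prop where
  isTree : T.IsTree
  ncard_children : ∀ v, (children T r v).Nonempty → (children T r v).ncard = M
  level_leaf : ∀ v, children T r v = ∅ → T.dist r v = h

end Trees

end LeaderSelection

/-! Diagonalising `L_ff` turns the follower noise into independent modes; a mode of frequency λ > 0
has limiting variance 1/(2λ), so the coherence is half the trace of `L_ff⁻¹` when that inverse
exists, and infinite without leaders. By `hasCoherence_of_green` any explicit Green function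
vanishing on the leaders computes this trace. On a tree the distance to a fixed node has an explicit
Laplacian, because exactly one neighbour of any other node is closer. This gives the Green function
for one leader, and a rank-one correction gives it for two. The pair coherence then depends only on
the distance sums D(x), D(y), the distance l = d(x,y) and Q = Σ (d(x,v) - d(y,v))²
(`hasCoherence_pair`). In the perfect binary tree, moving a leader to a child changes D and Q by
amounts depending only on subtree sizes. Induction along the tree (`exists_pair_shape`) thus
expresses Q through the depth m of the last common ancestor and the distances p, q from it to the
leaders. With N = n + 1 = 2^(h+1), twice the coherence is that of the root alone plus `pairExcess`,
which is affine in N. It remains to minimise over m, p, q. The triple (0,2,2) attains the smallest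
slope -9/8. As N ≥ 32, every other triple is strictly worse, except that (0,1,2) and its mirror
image tie exactly at N = 32, that is, at h = 4 (`pairExcess_ge`). Fewer than two leaders are
strictly worse as well. -/

namespace LeaderSelection

/-! ### Functional calculus of a real symmetric matrix -/

section Spectral

variable {n : Type*} [Fintype n] [DecidableEq n]

/-- Conjugation of a diagonal matrix by the eigenbasis of a symmetric matrix. -/
noncomputable def diagConj {A : Matrix n n ℝ} (hA : A.IsHermitian) (c : n → ℝ) : Matrix n n ℝ :=
  (hA.eigenvectorUnitary : Matrix n n ℝ) * Matrix.diagonal c *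
    (hA.eigenvectorUnitary : Matrix n n ℝ)ᵀ

theorem eigenvectorUnitary_transpose_mul {A : Matrix n n ℝ} (hA : A.IsHermitian) :
    (hA.eigenvectorUnitary : Matrix n n ℝ)ᵀ * (hA.eigenvectorUnitary : Matrix n n ℝ) = 1 := by
  have := (Matrix.mem_unitaryGroup_iff').1 hA.eigenvectorUnitary.2
  simpa [Matrix.star_eq_conjTranspose] using this

theorem eigenvectorUnitary_mul_transpose {A : Matrix n n ℝ} (hA : A.IsHermitian) :
    (hA.eigenvectorUnitary : Matrix n n ℝ) * (hA.eigenvectorUnitary : Matrix n n ℝ)ᵀ = 1 := by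
  have := (Matrix.mem_unitaryGroup_iff).1 hA.eigenvectorUnitary.2
  simpa [Matrix.star_eq_conjTranspose] using this

theorem diagConj_eigenvalues {A : Matrix n n ℝ} (hA : A.IsHermitian) :
    diagConj hA hA.eigenvalues = A := by
  conv_rhs => rw [hA.spectral_theorem, Unitary.conjStarAlgAut_apply]
  simp [diagConj, Matrix.star_eq_conjTranspose]

theorem diagConj_mul {A : Matrix n n ℝ} (hA : A.IsHermitian) (c d : n → ℝ) :
    diagConj hA c * diagConj hA d = diagConj hA (fun k => c k * d k) := by
  have e := eigenvectorUnitary_transpose_mul hA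
  unfold diagConj
  rw [← Matrix.diagonal_mul_diagonal]
  simp only [Matrix.mul_assoc]
  rw [← Matrix.mul_assoc (_ᵀ) _ (Matrix.diagonal d * _), e, Matrix.one_mul]

theorem diagConj_transpose {A : Matrix n n ℝ} (hA : A.IsHermitian) (c : n → ℝ) :
    (diagConj hA c)ᵀ = diagConj hA c := by
  simp [diagConj, Matrix.mul_assoc]

theorem diagConj_one {A : Matrix n n ℝ} (hA : A.IsHermitian) :
    diagConj hA (fun _ => 1) = 1 := by
  have e := eigenvectorUnitary_mul_transpose hA
  simp [diagConj, e]

theorem trace_diagConj {A : Matrix n n ℝ} (hA : A.IsHermitian) (c : n → ℝ) :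
    (diagConj hA c).trace = ∑ k, c k := by
  have e := eigenvectorUnitary_transpose_mul hA
  rw [diagConj, Matrix.mul_assoc, Matrix.trace_mul_comm, Matrix.mul_assoc, e, Matrix.mul_one,
    Matrix.trace_diagonal]

theorem diagConj_apply {A : Matrix n n ℝ} (hA : A.IsHermitian) (c : n → ℝ) (i j : n) :
    diagConj hA c i j = ∑ k, (hA.eigenvectorUnitary : Matrix n n ℝ) i k *
      (hA.eigenvectorUnitary : Matrix n n ℝ) j k * c k := by
  rw [diagConj, Matrix.mul_apply]
  refine Finset.sum_congr rfl fun k _ => ?_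
  rw [Matrix.mul_diagonal, Matrix.transpose_apply]
  ring

theorem posSemidef_diagConj {A : Matrix n n ℝ} (hA : A.IsHermitian) {c : n → ℝ}
    (hc : ∀ k, 0 ≤ c k) : (diagConj hA c).PosSemidef := by
  have := (Matrix.PosSemidef.diagonal (d := c) hc).mul_mul_conjTranspose_same
    (hA.eigenvectorUnitary : Matrix n n ℝ)
  simpa [diagConj, Matrix.conjTranspose_eq_transpose_of_trivial] using this

/-- The exponential commutes with conjugation and acts entrywise on diagonal matrices. -/
theorem exp_neg_smul_eq_diagConj {A : Matrix n n ℝ} (hA : A.IsHermitian) (t : ℝ) :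
    NormedSpace.exp (-(t • A)) = diagConj hA (fun k => Real.exp (-(t * hA.eigenvalues k))) := by
  have e := eigenvectorUnitary_mul_transpose hA
  have hinv : (hA.eigenvectorUnitary : Matrix n n ℝ)⁻¹ =
      (hA.eigenvectorUnitary : Matrix n n ℝ)ᵀ := Matrix.inv_eq_right_inv e
  have hu : IsUnit (hA.eigenvectorUnitary : Matrix n n ℝ) :=
    (Matrix.isUnit_iff_isUnit_det _).2 (Matrix.isUnit_det_of_right_inverse e)
  have h1 : -(t • A) = (hA.eigenvectorUnitary : Matrix n n ℝ) *
      Matrix.diagonal (fun k => -(t * hA.eigenvalues k)) *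
      (hA.eigenvectorUnitary : Matrix n n ℝ)⁻¹ := by
    rw [hinv]
    conv_lhs => rw [← diagConj_eigenvalues hA]
    ext i j
    change _ = diagConj hA _ i j
    simp only [Matrix.neg_apply, Matrix.smul_apply, diagConj_apply, smul_eq_mul, Finset.mul_sum,
      ← Finset.sum_neg_distrib]
    exact Finset.sum_congr rfl fun k _ => by ring
  rw [h1, Matrix.exp_conj _ _ hu, Matrix.exp_diagonal, hinv, diagConj]
  congr 3
  ext k
  rw [Pi.coe_exp, Real.exp_eq_exp_ℝ]

end Spectral

/-! ### Limiting variance of the follower process -/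

section Dynamics

variable {V : Type*} [Fintype V] [DecidableEq V]

theorem posSemidef_followerLaplacian (G : SimpleGraph V) [DecidableRel G.Adj] (S : Finset V) :
    (followerLaplacian G S).PosSemidef :=
  (G.posSemidef_lapMatrix ℝ).submatrix _

/-- The spectral frequencies of the follower dynamics. -/
noncomputable def followerEigenvalue (G : SimpleGraph V) [DecidableRel G.Adj] (S : Finset V) :
    Follower S → ℝ :=
  (posSemidef_followerLaplacian G S).1.eigenvalues

theorem flow_eq_diagConj (G : SimpleGraph V) [DecidableRel G.Adj] (S : Finset V) (t : ℝ) :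
    flow G S t = diagConj (posSemidef_followerLaplacian G S).1
      (fun k => Real.exp (-(t * followerEigenvalue G S k))) :=
  exp_neg_smul_eq_diagConj _ t

theorem flow_mul_transpose (G : SimpleGraph V) [DecidableRel G.Adj] (S : Finset V) (t : ℝ) :
    flow G S t * (flow G S t)ᵀ = diagConj (posSemidef_followerLaplacian G S).1
      (fun k => Real.exp (-(2 * followerEigenvalue G S k) * t)) := by
  rw [flow_eq_diagConj, diagConj_transpose, diagConj_mul]
  congr 1
  ext k
  rw [← Real.exp_add]
  ring_nf

theorem followerCov_eq_diagConj (G : SimpleGraph V) [DecidableRel G.Adj] (S : Finset V) (t : ℝ) :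
    followerCov G S t = diagConj (posSemidef_followerLaplacian G S).1
      (fun k => ∫ s in (0 : ℝ)..t, Real.exp (-(2 * followerEigenvalue G S k) * s)) := by
  ext i j
  simp only [followerCov, Matrix.of_apply, flow_mul_transpose, diagConj_apply]
  rw [intervalIntegral.integral_finsetSum]
  · simp only [intervalIntegral.integral_const_mul]
  · intro k _
    exact Continuous.intervalIntegrable (by fun_prop) _ _

theorem posSemidef_followerCov (G : SimpleGraph V) [DecidableRel G.Adj] (S : Finset V) {t : ℝ}
    (ht : 0 ≤ t) : (followerCov G S t).PosSemidef := by
  rw [followerCov_eq_diagConj]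
  exact posSemidef_diagConj _ fun k =>
    intervalIntegral.integral_nonneg ht fun s _ => (Real.exp_pos _).le

/-- Each coordinate is a real Gaussian, with second moment mean² plus variance; positive
semidefiniteness makes the diagonal entry the true variance. -/
theorem lintegral_sq_multivariateGaussian {ι : Type*} [Fintype ι] [DecidableEq ι]
    (μ : EuclideanSpace ℝ ι) {C : Matrix ι ι ℝ} (hC : C.PosSemidef) (i : ι) :
    ∫⁻ x, ENNReal.ofReal (x i ^ 2) ∂(ProbabilityTheory.multivariateGaussian μ C) =
      ENNReal.ofReal (μ i ^ 2 + C i i) := by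
  have hmp := ProbabilityTheory.measurePreserving_eval_multivariateGaussian (μ := μ) hC (i := i)
  rw [hmp.lintegral_comp (f := fun y : ℝ => ENNReal.ofReal (y ^ 2)) (by fun_prop)]
  have hL : MeasureTheory.MemLp id 2
      (ProbabilityTheory.gaussianReal (μ i) (C i i).toNNReal) :=
    ProbabilityTheory.memLp_id_gaussianReal 2
  have hvar := ProbabilityTheory.variance_eq_sub hL
  rw [ProbabilityTheory.variance_id_gaussianReal] at hvar
  simp only [Pi.pow_apply, id_eq, ProbabilityTheory.integral_id_gaussianReal] at hvar
  rw [← MeasureTheory.ofReal_integral_eq_lintegral_ofReal]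
  · rw [Real.coe_toNNReal _ (hC.diag_nonneg)] at hvar
    congr 1
    linarith
  · exact hL.integrable_sq
  · exact Filter.Eventually.of_forall fun y => sq_nonneg y

theorem totalVariance_eq (G : SimpleGraph V) [DecidableRel G.Adj] (S : Finset V)
    (x₀ : Follower S → ℝ) {t : ℝ} (ht : 0 ≤ t) :
    totalVariance G S x₀ t = ENNReal.ofReal (∑ i, ((flow G S t *ᵥ x₀) i) ^ 2 +
      ∑ k, ∫ s in (0 : ℝ)..t, Real.exp (-(2 * followerEigenvalue G S k) * s)) := by
  have hC := posSemidef_followerCov G S ht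
  have htr : ∑ k, ∫ s in (0 : ℝ)..t, Real.exp (-(2 * followerEigenvalue G S k) * s) =
      ∑ i, followerCov G S t i i := by
    rw [← trace_diagConj (posSemidef_followerLaplacian G S).1, ← followerCov_eq_diagConj]
    rfl
  rw [htr, ← Finset.sum_add_distrib, totalVariance, ENNReal.ofReal_sum_of_nonneg]
  · exact Finset.sum_congr rfl fun i _ => lintegral_sq_multivariateGaussian _ hC i
  · intro i _
    exact add_nonneg (sq_nonneg _) hC.diag_nonneg

theorem integral_exp_neg_mul {a : ℝ} (ha : a ≠ 0) (t : ℝ) :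
    ∫ s in (0 : ℝ)..t, Real.exp (-a * s) = (1 - Real.exp (-a * t)) / a := by
  rw [intervalIntegral.integral_comp_mul_left (fun s => Real.exp s) (neg_ne_zero.2 ha),
    integral_exp]
  simp only [mul_zero, Real.exp_zero, smul_eq_mul]
  field_simp
  ring

theorem tendsto_sum_zero {ι α : Type*} [Fintype ι] {l : Filter α} {f : ι → α → ℝ}
    (hf : ∀ i, Filter.Tendsto (f i) l (𝓝 0)) :
    Filter.Tendsto (fun a => ∑ i, f i a) l (𝓝 0) := by
  simpa using tendsto_finsetSum Finset.univ fun i _ => hf i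

theorem tendsto_mul_const_zero {α : Type*} {l : Filter α} {f : α → ℝ}
    (hf : Filter.Tendsto f l (𝓝 0)) (c : ℝ) : Filter.Tendsto (fun a => f a * c) l (𝓝 0) := by
  simpa using hf.mul_const c

theorem tendsto_const_mul_zero {α : Type*} {l : Filter α} {f : α → ℝ} (c : ℝ)
    (hf : Filter.Tendsto f l (𝓝 0)) : Filter.Tendsto (fun a => c * f a) l (𝓝 0) := by
  simpa using hf.const_mul c

/-- A right inverse of the follower Laplacian determines the coherence. -/
theorem hasCoherence_of_mul_eq_one (G : SimpleGraph V) [DecidableRel G.Adj] (S : Finset V)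
    (B : Matrix (Follower S) (Follower S) ℝ) (hB : followerLaplacian G S * B = 1) :
    HasCoherence G S (ENNReal.ofReal (B.trace / 2)) := by
  have hH := (posSemidef_followerLaplacian G S)
  have hunit : IsUnit (followerLaplacian G S) :=
    (Matrix.isUnit_iff_isUnit_det _).2 (Matrix.isUnit_det_of_right_inverse hB)
  have hpos : ∀ k, 0 < followerEigenvalue G S k :=
    (hH.1.posDef_iff_eigenvalues_pos).1 (hH.posDef_iff_isUnit.2 hunit)
  have hinv : followerLaplacian G S * diagConj hH.1 (fun k => (followerEigenvalue G S k)⁻¹) = 1 := by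
    conv_lhs => enter [1]; rw [← diagConj_eigenvalues hH.1]
    rw [diagConj_mul, ← diagConj_one hH.1]
    congr 1
    ext k
    exact mul_inv_cancel₀ (hpos k).ne'
  have hBeq : B = diagConj hH.1 (fun k => (followerEigenvalue G S k)⁻¹) := by
    rw [← Matrix.inv_eq_right_inv hB, ← Matrix.inv_eq_right_inv hinv]
  -- The 0 is the limit of the squared mean; each summand is ∫ exp(-2λs) ds over [0, ∞).
  have htr : B.trace / 2 = 0 + ∑ k, 1 / (2 * followerEigenvalue G S k) := by
    rw [hBeq, trace_diagConj, Finset.sum_div, zero_add]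
    refine Finset.sum_congr rfl fun k _ => ?_
    have := (hpos k).ne'
    field_simp
  intro x₀
  have hdecay : ∀ a : ℝ, 0 < a →
      Filter.Tendsto (fun t : ℝ => Real.exp (-a * t)) Filter.atTop (𝓝 0) := fun a ha =>
    Real.tendsto_exp_atBot.comp
      ((Filter.tendsto_id.const_mul_atTop_of_neg (neg_lt_zero.2 ha)))
  have hflow : ∀ i, Filter.Tendsto (fun t => (flow G S t *ᵥ x₀) i) Filter.atTop (𝓝 0) := by
    intro i
    simp only [Matrix.mulVec, dotProduct, flow_eq_diagConj, diagConj_apply]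
    refine tendsto_sum_zero fun j => ?_
    refine tendsto_mul_const_zero (tendsto_sum_zero fun k => ?_) _
    refine tendsto_const_mul_zero _ ?_
    refine (hdecay _ (hpos k)).congr fun t => ?_
    ring_nf
  have hlim : Filter.Tendsto (fun t => ∑ i, ((flow G S t *ᵥ x₀) i) ^ 2 +
      ∑ k, ∫ s in (0 : ℝ)..t, Real.exp (-(2 * followerEigenvalue G S k) * s)) Filter.atTop
      (𝓝 (B.trace / 2)) := by
    rw [htr]
    refine Filter.Tendsto.add ?_ (tendsto_finsetSum _ fun k _ => ?_)
    · refine tendsto_sum_zero fun i => ?_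
      simpa using (hflow i).pow 2
    · have h2 : 0 < 2 * followerEigenvalue G S k := by linarith [hpos k]
      simp only [integral_exp_neg_mul h2.ne']
      simpa using ((hdecay _ h2).const_sub 1).div_const (2 * followerEigenvalue G S k)
  refine (ENNReal.tendsto_ofReal hlim).congr' ?_
  filter_upwards [Filter.eventually_ge_atTop 0] with t ht
  exact (totalVariance_eq G S x₀ ht).symm

/-- Without leaders the coherence is infinite. -/
theorem hasCoherence_empty (G : SimpleGraph V) [DecidableRel G.Adj] [Nonempty V] :
    HasCoherence G ∅ ⊤ := by
  have hH := (posSemidef_followerLaplacian G (∅ : Finset V))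
  obtain ⟨v₀⟩ := ‹Nonempty V›
  have hne : Nonempty (Follower (∅ : Finset V)) := ⟨⟨v₀, Finset.notMem_empty _⟩⟩
  -- Constants are harmonic, so with no Dirichlet node 0 is an eigenvalue, and its mode accumulates
  -- variance t.
  have hker : followerLaplacian G ∅ *ᵥ (fun _ => 1) = 0 := by
    ext i
    have h1 := congrFun (G.lapMatrix_mulVec_const_eq_zero (R := ℝ)) i.1
    simp only [Matrix.mulVec, dotProduct, Pi.zero_apply] at h1 ⊢
    rw [← h1]
    exact Fintype.sum_equiv (Equiv.subtypeUnivEquiv fun v => Finset.notMem_empty v) _ _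
      fun k => rfl
  have hdet : (followerLaplacian G ∅).det = 0 := by
    refine Matrix.exists_mulVec_eq_zero_iff.1 ⟨fun _ => 1, ?_, hker⟩
    intro h0
    exact one_ne_zero (congrFun h0 ⟨v₀, Finset.notMem_empty _⟩)
  obtain ⟨k₀, hk₀⟩ : ∃ k, followerEigenvalue G ∅ k = 0 := by
    rw [hH.1.det_eq_prod_eigenvalues] at hdet
    obtain ⟨k, _, hk⟩ := Finset.prod_eq_zero_iff.1 hdet
    exact ⟨k, hk⟩
  intro x₀
  refine tendsto_of_tendsto_of_tendsto_of_le_of_le' (g := fun t => ENNReal.ofReal t)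
    ENNReal.tendsto_ofReal_atTop tendsto_const_nhds ?_ (Filter.Eventually.of_forall fun _ => le_top)
  filter_upwards [Filter.eventually_ge_atTop 0] with t ht
  rw [totalVariance_eq G ∅ x₀ ht]
  refine ENNReal.ofReal_le_ofReal ?_
  have h1 : t = ∫ s in (0 : ℝ)..t, Real.exp (-(2 * followerEigenvalue G ∅ k₀) * s) := by
    simp [hk₀]
  have h2 : ∫ s in (0 : ℝ)..t, Real.exp (-(2 * followerEigenvalue G ∅ k₀) * s) ≤
      ∑ k, ∫ s in (0 : ℝ)..t, Real.exp (-(2 * followerEigenvalue G ∅ k) * s) :=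
    Finset.single_le_sum (f := fun k => ∫ s in (0 : ℝ)..t,
      Real.exp (-(2 * followerEigenvalue G ∅ k) * s))
      (fun k _ => intervalIntegral.integral_nonneg ht fun s _ => (Real.exp_pos _).le)
      (Finset.mem_univ k₀)
  have h3 : 0 ≤ ∑ i, ((flow G ∅ t *ᵥ x₀) i) ^ 2 := Finset.sum_nonneg fun i _ => sq_nonneg _
  linarith

theorem HasCoherence.unique {G : SimpleGraph V} [DecidableRel G.Adj] {S : Finset V}
    {R R' : ℝ≥0∞} (h : HasCoherence G S R) (h' : HasCoherence G S R') : R = R' :=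
  tendsto_nhds_unique (h 0) (h' 0)

end Dynamics

/-! ### Coherence as the trace of a Green function -/

section Green

variable {V : Type*} [Fintype V] [DecidableEq V]

/-- A Green function of the Laplacian with Dirichlet condition on `S` determines the coherence. -/
theorem hasCoherence_of_green (G : SimpleGraph V) [DecidableRel G.Adj] (S : Finset V)
    (g : V → V → ℝ) (h0 : ∀ s ∈ S, ∀ j, g s j = 0)
    (h1 : ∀ i ∉ S, ∀ j, (G.lapMatrix ℝ *ᵥ fun k => g k j) i = if i = j then 1 else 0) :
    HasCoherence G S (ENNReal.ofReal ((∑ v, g v v) / 2)) := by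
  have hsum : ∀ f : V → ℝ, (∀ s ∈ S, f s = 0) → ∑ k : Follower S, f k = ∑ k, f k := by
    intro f hf
    rw [← Finset.sum_subtype Sᶜ (fun x => Finset.mem_compl) f]
    exact Finset.sum_subset (Finset.subset_univ _) fun s _ hs => hf s (by simpa using hs)
  have := hasCoherence_of_mul_eq_one G S (Matrix.of fun i j => g i j) ?_
  · rwa [← hsum (fun v => g v v) fun s hs => h0 s hs s]
  · ext i j
    rw [Matrix.mul_apply, Matrix.one_apply]
    have e := h1 i i.2 j
    simp only [Subtype.ext_iff]
    rw [← e]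
    exact hsum (fun k => G.lapMatrix ℝ i k * g k j) fun s hs => by rw [h0 s hs, mul_zero]

end Green

/-! ### Green functions of trees with one or two leaders -/

section TreeMetric

variable {V : Type*} {T : SimpleGraph V}

theorem dist_symm (T : SimpleGraph V) (u v : V) : T.dist u v = T.dist v u := T.dist_comm

theorem exists_adj_dist_eq (hT : T.IsTree) {u v : V} (huv : u ≠ v) :
    ∃ w, T.Adj u w ∧ T.dist u v = T.dist w v + 1 := by
  obtain ⟨p, hp⟩ := hT.connected.exists_walk_length_eq_dist u v
  cases p with
  | nil => exact absurd rfl huv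
  | @cons _ w _ hadj p =>
    refine ⟨w, hadj, ?_⟩
    have h1 := T.dist_le p
    have h2 := hT.connected.dist_triangle (u := u) (v := w) (w := v)
    have h3 := SimpleGraph.dist_eq_one_iff_adj.2 hadj
    simp only [SimpleGraph.Walk.length_cons] at hp
    omega

/-- Both neighbours start a shortest path from `u` to `v`, and paths in a tree are unique. -/
theorem eq_of_adj_of_dist_eq (hT : T.IsTree) {u v w w' : V} (hw : T.Adj u w) (hw' : T.Adj u w')
    (hd : T.dist u v = T.dist w v + 1) (hd' : T.dist u v = T.dist w' v + 1) : w = w' := by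
  obtain ⟨p, hp⟩ := hT.connected.exists_walk_length_eq_dist w v
  obtain ⟨p', hp'⟩ := hT.connected.exists_walk_length_eq_dist w' v
  have h1 : (SimpleGraph.Walk.cons hw p).IsPath :=
    SimpleGraph.Walk.isPath_of_length_eq_dist _ (by simp [hp, hd])
  have h2 : (SimpleGraph.Walk.cons hw' p').IsPath :=
    SimpleGraph.Walk.isPath_of_length_eq_dist _ (by simp [hp', hd'])
  have h3 := (hT.existsUnique_path u v).unique h1 h2
  injection h3

theorem dist_adj_cases (hT : T.IsTree) {u w : V} (hw : T.Adj u w) (v : V) :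
    T.dist u v = T.dist w v + 1 ∨ T.dist w v = T.dist u v + 1 := by
  rw [dist_symm T u, dist_symm T w]
  exact hT.dist_eq_dist_add_one_of_adj v hw

/-- Away from `v` one neighbour is a step closer and all others a step farther; at `v` none is
closer, which costs the extra 2. -/
theorem lapMatrix_mulVec_dist [Fintype V] [DecidableEq V] [DecidableRel T.Adj] (hT : T.IsTree)
    (v u : V) :
    (T.lapMatrix ℝ *ᵥ fun k => (T.dist k v : ℝ)) u = 2 - T.degree u - if u = v then 2 else 0 := by
  rw [SimpleGraph.lapMatrix_mulVec_apply]
  split_ifs with huv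
  · subst huv
    have : ∑ w ∈ T.neighborFinset u, (T.dist w u : ℝ) = ∑ w ∈ T.neighborFinset u, 1 := by
      refine Finset.sum_congr rfl fun w hw => ?_
      rw [T.mem_neighborFinset] at hw
      rw [SimpleGraph.dist_eq_one_iff_adj.2 hw.symm, Nat.cast_one]
    rw [this]
    simp
  · obtain ⟨c, hc, hcd⟩ := exists_adj_dist_eq hT huv
    have : ∑ w ∈ T.neighborFinset u, (T.dist w v : ℝ) =
        ∑ w ∈ T.neighborFinset u, ((T.dist u v + 1 : ℝ) - if w = c then 2 else 0) := by
      refine Finset.sum_congr rfl fun w hw => ?_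
      rw [T.mem_neighborFinset] at hw
      split_ifs with hwc
      · rw [hwc, hcd]
        push_cast
        ring
      · rcases dist_adj_cases hT hw v with h | h
        · exact absurd (eq_of_adj_of_dist_eq hT hw hc h hcd) hwc
        · rw [h]
          push_cast
          ring
    rw [this, Finset.sum_sub_distrib, Finset.sum_ite_eq',
      if_pos ((T.mem_neighborFinset u c).2 hc)]
    simp
    ring

/-- The Green function of the Laplacian of a tree with Dirichlet condition at `x`. -/
noncomputable def treeGreen (T : SimpleGraph V) (x k j : V) : ℝ :=
  (T.dist k x + T.dist j x - T.dist k j) / 2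

/-- The terms 2 - degree cancel between the two distance functions, leaving point masses at `x` and
`j`. -/
theorem lapMatrix_mulVec_treeGreen [Fintype V] [DecidableEq V] [DecidableRel T.Adj]
    (hT : T.IsTree) {x i : V} (hi : i ≠ x) (j : V) :
    (T.lapMatrix ℝ *ᵥ fun k => treeGreen T x k j) i = if i = j then 1 else 0 := by
  have e : (fun k => treeGreen T x k j) = (1 / 2 : ℝ) • ((fun k => (T.dist k x : ℝ)) -
      (fun k => (T.dist k j : ℝ)) + (T.dist j x : ℝ) • fun _ => (1 : ℝ)) := by
    ext k
    simp only [treeGreen, Pi.smul_apply, Pi.add_apply, Pi.sub_apply, smul_eq_mul]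
    ring
  rw [e, Matrix.mulVec_smul, Matrix.mulVec_add, Matrix.mulVec_sub, Matrix.mulVec_smul,
    SimpleGraph.lapMatrix_mulVec_const_eq_zero]
  simp only [Pi.smul_apply, Pi.add_apply, Pi.sub_apply, smul_eq_mul, Pi.zero_apply,
    lapMatrix_mulVec_dist hT, if_neg hi]
  split_ifs <;> ring

/-- The sum of the distances from `x` to all nodes. -/
noncomputable def distSum [Fintype V] (T : SimpleGraph V) (x : V) : ℝ :=
  ∑ v, (T.dist x v : ℝ)

/-- The sum of the squared differences of the distances to `x` and `y` over all nodes. -/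
noncomputable def sqDiffSum [Fintype V] (T : SimpleGraph V) (x y : V) : ℝ :=
  ∑ v, ((T.dist x v : ℝ) - T.dist y v) ^ 2

theorem hasCoherence_singleton [Fintype V] [DecidableEq V] [DecidableRel T.Adj]
    (hT : T.IsTree) (x : V) : HasCoherence T {x} (ENNReal.ofReal (distSum T x / 2)) := by
  have := hasCoherence_of_green T {x} (treeGreen T x) ?_ ?_
  · convert this using 4 with v
    refine Finset.sum_congr rfl fun v _ => ?_
    simp [treeGreen, dist_symm T x v]
  · intro s hs j
    rw [Finset.mem_singleton] at hs
    simp [treeGreen, hs, dist_symm T x j]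
  · intro i hi j
    exact lapMatrix_mulVec_treeGreen hT (fun h => hi (by simp [h])) j

theorem hasCoherence_pair [Fintype V] [DecidableEq V] [DecidableRel T.Adj]
    (hT : T.IsTree) {x y : V} (hxy : x ≠ y) :
    HasCoherence T {x, y} (ENNReal.ofReal (((distSum T x + distSum T y) / 2 -
      Fintype.card V * T.dist x y / 4 - sqDiffSum T x y / (4 * T.dist x y)) / 2)) := by
  have hl : (T.dist x y : ℝ) ≠ 0 := by
    exact_mod_cast (hT.connected.pos_dist_of_ne hxy).ne'
  have hyy : treeGreen T x y y = T.dist x y := by simp [treeGreen, dist_symm T x y]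
  have hsymm : ∀ k j, treeGreen T x k j = treeGreen T x j k := fun k j => by
    rw [treeGreen, treeGreen, dist_symm T k j]
    ring
  -- Subtracting a multiple of the column of `y` forces the value 0 at `y`; that column is harmonic
  -- off `x` and `y`, so the equation at the followers survives.
  have := hasCoherence_of_green T {x, y} (fun k j => treeGreen T x k j -
    treeGreen T x k y * treeGreen T x j y / T.dist x y) ?_ ?_
  · convert this using 3
    have hD : ∑ v : V, (T.dist x y : ℝ) = Fintype.card V * T.dist x y := by simp
    have e : ∀ v : V, treeGreen T x v v - treeGreen T x v y * treeGreen T x v y / T.dist x y =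
        ((T.dist x v : ℝ) + T.dist y v) / 2 - (T.dist x y : ℝ) / 4 -
          ((T.dist x v : ℝ) - T.dist y v) ^ 2 / (4 * T.dist x y) := by
      intro v
      simp only [treeGreen, dist_symm T v x, dist_symm T v y, dist_symm T y x, T.dist_self,
        Nat.cast_zero]
      field_simp
      ring
    simp only [e, Finset.sum_sub_distrib, ← Finset.sum_div, Finset.sum_add_distrib, hD]
    rfl
  · intro s hs j
    simp only [Finset.mem_insert, Finset.mem_singleton] at hs
    rcases hs with rfl | rfl
    · simp [treeGreen, dist_symm T s j, dist_symm T s y]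
    · rw [hyy, hsymm s j]
      field_simp
      ring
  · intro i hi j
    have hix : i ≠ x := fun h => hi (by simp [h])
    have hiy : i ≠ y := fun h => hi (by simp [h])
    have e : (fun k => treeGreen T x k j - treeGreen T x k y * treeGreen T x j y / T.dist x y) =
        (fun k => treeGreen T x k j) - (treeGreen T x j y / (T.dist x y : ℝ)) •
          fun k => treeGreen T x k y := by
      ext k
      simp only [Pi.sub_apply, Pi.smul_apply, smul_eq_mul]
      ring
    rw [e, Matrix.mulVec_sub, Matrix.mulVec_smul, Pi.sub_apply, Pi.smul_apply,
      lapMatrix_mulVec_treeGreen hT hix, lapMatrix_mulVec_treeGreen hT hix, if_neg hiy, smul_zero,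
      sub_zero]

end TreeMetric

/-! ### Subtrees, and moving a leader to a child -/

section Descendants

variable {V : Type*} {T : SimpleGraph V}

/-- `v` lies below `u` in the tree `T` rooted at `r`. -/
def IsBelow (T : SimpleGraph V) (r u v : V) : Prop :=
  T.dist r v = T.dist r u + T.dist u v

theorem IsBelow.dist_parent (hT : T.IsTree) {r w u v : V} (hc : u ∈ children T r w)
    (hv : IsBelow T r u v) : T.dist w v = T.dist u v + 1 := by
  have h1 := hT.connected.dist_triangle (u := r) (v := w) (w := v)
  have h2 := hc.2
  rcases dist_adj_cases hT hc.1 v with h | h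
  · exact h
  · unfold IsBelow at hv
    omega

theorem isBelow_of_dist_eq (hT : T.IsTree) {r w u v : V} (hc : u ∈ children T r w)
    (hd : T.dist w v = T.dist u v + 1) : IsBelow T r u v := by
  induction hk : T.dist u v generalizing w u with
  | zero =>
    rw [hT.connected.dist_eq_zero_iff] at hk
    simp [IsBelow, hk]
  | succ k ih =>
    have hne : u ≠ v := by
      rintro rfl
      simp at hk
    obtain ⟨u', hu', hd'⟩ := exists_adj_dist_eq hT hne
    -- If the next node towards `v` were nearer the root, it would be the parent `w`, which is
    -- farther from `v`.
    have hdep : T.dist r u' = T.dist r u + 1 := by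
      rcases hT.dist_eq_dist_add_one_of_adj r hu' with h | h
      · have h2 := hc.2
        have : u' = w := eq_of_adj_of_dist_eq hT (v := r) hu' hc.1.symm
          (by rw [dist_symm T u, dist_symm T u']; exact h)
          (by rw [dist_symm T u, dist_symm T w]; exact h2)
        rw [this] at hd'
        omega
      · exact h
    have := ih ⟨hu', hdep⟩ hd' (by omega)
    unfold IsBelow at this ⊢
    omega

theorem dist_eq_of_not_isBelow (hT : T.IsTree) {r w u v : V} (hc : u ∈ children T r w)
    (hv : ¬ IsBelow T r u v) : T.dist u v = T.dist w v + 1 := by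
  rcases dist_adj_cases hT hc.1 v with h | h
  · exact absurd (isBelow_of_dist_eq hT hc h) hv
  · exact h

theorem exists_parent (hT : T.IsTree) {r u : V} (hu : u ≠ r) : ∃ w, u ∈ children T r w := by
  obtain ⟨w, hw, hd⟩ := exists_adj_dist_eq hT hu
  exact ⟨w, hw.symm, by rw [dist_symm T r u, dist_symm T r w]; exact hd⟩

theorem isBelow_self (r u : V) : IsBelow T r u u := by simp [IsBelow]

theorem isBelow_root (r v : V) : IsBelow T r r v := by simp [IsBelow]

theorem isBelow_iff_children (hT : T.IsTree) {r u v : V} :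
    IsBelow T r u v ↔ v = u ∨ ∃ c ∈ children T r u, IsBelow T r c v := by
  constructor
  · intro h
    by_cases huv : u = v
    · exact Or.inl huv.symm
    obtain ⟨c, hc, hd⟩ := exists_adj_dist_eq hT huv
    have h1 := hT.connected.dist_triangle (u := r) (v := c) (w := v)
    have h2 : T.dist r c = T.dist r u + 1 := by
      unfold IsBelow at h
      rcases hT.dist_eq_dist_add_one_of_adj r hc with h | h <;> omega
    refine Or.inr ⟨c, ⟨hc, h2⟩, ?_⟩
    unfold IsBelow at h ⊢
    omega
  · rintro (rfl | ⟨c, hc, hcv⟩)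
    · exact isBelow_self r v
    · have h1 := IsBelow.dist_parent hT hc hcv
      have h2 := hc.2
      unfold IsBelow at hcv ⊢
      omega

theorem not_isBelow_parent {r w c : V} (hc : c ∈ children T r w) :
    ¬ IsBelow T r c w := by
  intro h
  have := hc.2
  unfold IsBelow at h
  omega

theorem children_eq_of_isBelow (hT : T.IsTree) {r u v c c' : V} (hc : c ∈ children T r u)
    (hc' : c' ∈ children T r u) (hv : IsBelow T r c v) (hv' : IsBelow T r c' v) : c = c' :=
  eq_of_adj_of_dist_eq hT hc.1 hc'.1 (hv.dist_parent hT hc) (hv'.dist_parent hT hc')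

open Classical in
/-- The nodes below `u`, including `u`. -/
noncomputable def below [Fintype V] (T : SimpleGraph V) (r u : V) : Finset V :=
  Finset.univ.filter (IsBelow T r u)

theorem mem_below [Fintype V] {r u v : V} : v ∈ below T r u ↔ IsBelow T r u v := by
  simp [below]

theorem sum_below_of_leaf [Fintype V] (hT : T.IsTree) {r u : V} (hu : children T r u = ∅)
    (f : V → ℝ) : ∑ v ∈ below T r u, f v = f u := by
  have : below T r u = {u} := by
    ext v
    rw [mem_below, isBelow_iff_children hT, hu]
    simp
  rw [this, Finset.sum_singleton]

theorem sum_below_of_children [Fintype V] (hT : T.IsTree) {r u c c' : V} (hne : c ≠ c')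
    (hu : children T r u = {c, c'}) (f : V → ℝ) :
    ∑ v ∈ below T r u, f v = f u + (∑ v ∈ below T r c, f v + ∑ v ∈ below T r c', f v) := by
  classical
  have hc : c ∈ children T r u := by simp [hu]
  have hc' : c' ∈ children T r u := by simp [hu]
  have hdisj : Disjoint (below T r c) (below T r c') := by
    rw [Finset.disjoint_left]
    intro v hv hv'
    rw [mem_below] at hv hv'
    exact hne (children_eq_of_isBelow hT hc hc' hv hv')
  have : below T r u = insert u (below T r c ∪ below T r c') := by
    ext v
    rw [mem_below, isBelow_iff_children hT, hu]
    simp [mem_below]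
  rw [this, Finset.sum_insert, Finset.sum_union hdisj]
  simp [mem_below, not_isBelow_parent hc, not_isBelow_parent hc']

/-- The step from `w` to `u` shortens the distance by 1 inside the subtree of `u` and lengthens it
by 1 elsewhere. -/
theorem distSum_child [Fintype V] (hT : T.IsTree) {r w u : V} (hc : u ∈ children T r w) :
    distSum T u = distSum T w + Fintype.card V - 2 * (below T r u).card := by
  classical
  have : ∀ v, (T.dist u v : ℝ) = T.dist w v + 1 - 2 * if v ∈ below T r u then 1 else 0 := by
    intro v
    split_ifs with h
    · rw [IsBelow.dist_parent hT hc (mem_below.1 h)]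
      push_cast
      ring
    · rw [dist_eq_of_not_isBelow hT hc (fun h' => h (mem_below.2 h'))]
      push_cast
      ring
  simp only [distSum, this, Finset.sum_sub_distrib, Finset.sum_add_distrib, ← Finset.mul_sum]
  simp

/-- The edge from `w` to `u` separates the subtree of `u` from `y`, so the path from `y` to `v`
passes through `w`. -/
theorem dist_eq_add_of_isBelow (hT : T.IsTree) {r w u v y : V} (hc : u ∈ children T r w)
    (hv : IsBelow T r u v) (hy : ¬ IsBelow T r u y) :
    T.dist y v = T.dist y w + T.dist w v := by
  induction hk : T.dist u v generalizing w u with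
  | zero =>
    rw [hT.connected.dist_eq_zero_iff] at hk
    subst hk
    have h1 := dist_eq_of_not_isBelow hT hc hy
    have h2 := SimpleGraph.dist_eq_one_iff_adj.2 hc.1
    rw [dist_symm T y u, dist_symm T y w]
    omega
  | succ k ih =>
    rcases (isBelow_iff_children hT).1 hv with rfl | ⟨c, hcu, hcv⟩
    · simp at hk
    · have h1 := IsBelow.dist_parent hT hcu hcv
      have h2 := ih hcu hcv (fun h => hy ((isBelow_iff_children hT).2 (Or.inr ⟨c, hcu, h⟩)))
        (by omega)
      have h3 := dist_eq_of_not_isBelow hT hc hy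
      have h4 := IsBelow.dist_parent hT hc hv
      rw [dist_symm T y u] at h2
      rw [dist_symm T y w]
      omega

theorem sqDiffSum_comm [Fintype V] (x y : V) : sqDiffSum T x y = sqDiffSum T y x :=
  Finset.sum_congr rfl fun v _ => by ring

/-- Outside the subtree of `u` the difference grows by 1. Inside it equals -d(w,y) and shrinks by 1,
so its square exceeds the outside pattern by 4 d(w,y). -/
theorem sqDiffSum_child [Fintype V] (hT : T.IsTree) {r w u y : V} (hc : u ∈ children T r w)
    (hy : ¬ IsBelow T r u y) :
    sqDiffSum T u y = sqDiffSum T w y + Fintype.card V + 2 * (distSum T w - distSum T y) +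
      4 * T.dist w y * (below T r u).card := by
  classical
  have : ∀ v, ((T.dist u v : ℝ) - T.dist y v) ^ 2 = ((T.dist w v : ℝ) - T.dist y v) ^ 2 + 1 +
      2 * ((T.dist w v : ℝ) - T.dist y v) +
        4 * T.dist w y * if v ∈ below T r u then 1 else 0 := by
    intro v
    split_ifs with h
    · have h1 : (T.dist y v : ℝ) = T.dist w y + T.dist w v := by
        rw [dist_symm T w y]
        exact_mod_cast dist_eq_add_of_isBelow hT hc (mem_below.1 h) hy
      have h2 : (T.dist w v : ℝ) = T.dist u v + 1 := by
        exact_mod_cast IsBelow.dist_parent hT hc (mem_below.1 h)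
      have h3 : (T.dist y v : ℝ) = T.dist u v + 1 + T.dist w y := by linarith
      rw [h3, h2]
      ring
    · rw [dist_eq_of_not_isBelow hT hc (fun h' => h (mem_below.2 h'))]
      push_cast
      ring
  simp only [sqDiffSum, distSum, this, Finset.sum_add_distrib, Finset.sum_sub_distrib,
    ← Finset.mul_sum]
  simp

end Descendants

/-! ### Distance sums in the perfect binary tree -/

section PerfectTree

theorem IsPerfectTree.exists_children {V : Type*} {T : SimpleGraph V} {r : V} {h : ℕ}
    (hT : IsPerfectTree T r 2 h) {u : V}
    (hu : T.dist r u < h) : ∃ c c', c ≠ c' ∧ children T r u = {c, c'} := by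
  refine Set.ncard_eq_two.1 (hT.ncard_children u ?_)
  by_contra hne
  have := hT.level_leaf u (Set.not_nonempty_iff_eq_empty.1 hne)
  omega

variable {V : Type*} [Fintype V] {T : SimpleGraph V} {r : V} {h : ℕ}

theorem IsPerfectTree.dist_le_height {M : ℕ} (hT : IsPerfectTree T r M h) (v : V) :
    T.dist r v ≤ h := by
  have : Nonempty V := ⟨r⟩
  obtain ⟨u, hu⟩ := Finite.exists_max fun v => T.dist r v
  have hleaf : children T r u = ∅ := by
    by_contra hne
    obtain ⟨c, hc⟩ := Set.nonempty_iff_ne_empty.2 hne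
    have h1 := hu c
    have h2 := hc.2
    omega
  have h1 := hT.level_leaf u hleaf
  have h2 := hu v
  omega

theorem IsPerfectTree.children_eq_empty (hT : IsPerfectTree T r 2 h) {u : V}
    (hu : T.dist r u = h) : children T r u = ∅ := by
  refine Set.eq_empty_of_forall_notMem fun c hc => ?_
  have h1 := hT.dist_le_height c
  have h2 := hc.2
  omega

theorem IsPerfectTree.card_below_and_sum_dist (hT : IsPerfectTree T r 2 h) (k : ℕ) :
    ∀ u, T.dist r u + k = h → ((below T r u).card : ℝ) = 2 ^ (k + 1) - 1 ∧
      ∑ v ∈ below T r u, (T.dist u v : ℝ) = (k - 1) * 2 ^ (k + 1) + 2 := by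
  have hcard : ∀ u, ((below T r u).card : ℝ) = ∑ v ∈ below T r u, (1 : ℝ) := fun u => by simp
  induction k with
  | zero =>
    intro u hu
    have hleaf := hT.children_eq_empty hu
    rw [hcard, sum_below_of_leaf hT.isTree hleaf, sum_below_of_leaf hT.isTree hleaf]
    norm_num
  | succ k ih =>
    intro u hu
    obtain ⟨c, c', hne, hch⟩ := hT.exists_children (u := u) (by omega)
    have hc : c ∈ children T r u := by simp [hch]
    have hc' : c' ∈ children T r u := by simp [hch]
    have step : ∀ c ∈ children T r u, ((below T r c).card : ℝ) = 2 ^ (k + 1) - 1 ∧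
        ∑ v ∈ below T r c, (T.dist u v : ℝ) = (k - 1) * 2 ^ (k + 1) + 2 + (2 ^ (k + 1) - 1) := by
      intro c hc
      have h2 := hc.2
      obtain ⟨e1, e2⟩ := ih c (by omega)
      refine ⟨e1, ?_⟩
      rw [← e2, ← e1, hcard, ← Finset.sum_add_distrib]
      refine Finset.sum_congr rfl fun v hv => ?_
      exact_mod_cast IsBelow.dist_parent hT.isTree hc (mem_below.1 hv)
    rw [hcard, sum_below_of_children hT.isTree hne hch, sum_below_of_children hT.isTree hne hch,
      ← hcard, ← hcard, (step c hc).1, (step c hc).2, (step c' hc').1, (step c' hc').2]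
    constructor
    · ring
    · rw [T.dist_self]
      push_cast
      ring

theorem IsPerfectTree.card_below (hT : IsPerfectTree T r 2 h) (u : V) :
    ((below T r u).card : ℝ) = 2 ^ (h + 1) * (1 / 2) ^ T.dist r u - 1 := by
  obtain ⟨k, hk⟩ := Nat.exists_eq_add_of_le (hT.dist_le_height u)
  rw [(hT.card_below_and_sum_dist k u hk.symm).1, hk, one_div, inv_pow, add_assoc, pow_add]
  field_simp
  ring

theorem below_root : below T r r = Finset.univ := by
  ext v
  simp [mem_below, isBelow_root]

theorem IsPerfectTree.card_eq (hT : IsPerfectTree T r 2 h) :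
    (Fintype.card V : ℝ) = 2 ^ (h + 1) - 1 := by
  have := hT.card_below r
  rw [below_root] at this
  simpa using this

theorem IsPerfectTree.distSum_root (hT : IsPerfectTree T r 2 h) :
    distSum T r = (h - 1) * 2 ^ (h + 1) + 2 := by
  have := (hT.card_below_and_sum_dist h r (by simp)).2
  rwa [below_root] at this

theorem IsPerfectTree.distSum_eq (hT : IsPerfectTree T r 2 h) (x : V) :
    distSum T x = (h - 1) * 2 ^ (h + 1) + 2 +
      2 ^ (h + 1) * (T.dist r x - 2 + 2 * (1 / 2) ^ T.dist r x) + T.dist r x := by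
  induction hi : T.dist r x generalizing x with
  | zero =>
    rw [hT.isTree.connected.dist_eq_zero_iff] at hi
    rw [← hi, hT.distSum_root]
    norm_num
  | succ i ih =>
    obtain ⟨w, hw⟩ := exists_parent hT.isTree (r := r) (u := x) (by rintro rfl; simp at hi)
    have h2 := hw.2
    rw [distSum_child hT.isTree hw, ih w (by omega), hT.card_eq, hT.card_below, hi]
    push_cast
    ring

/-- Here m is the depth of the last common ancestor. The distance sums stay unexpanded because they
cancel in the formula for the pair coherence. -/
theorem IsPerfectTree.exists_pair_shape (hT : IsPerfectTree T r 2 h) (x y : V) :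
    ∃ m p q : ℕ, T.dist r x = m + p ∧ T.dist r y = m + q ∧ T.dist x y = p + q ∧
      sqDiffSum T x y = 2 * (p + q) * (distSum T x + distSum T y) -
        Fintype.card V * (p + q) ^ 2 - 4 * ((p + q) * ((h - 1) * 2 ^ (h + 1) + 2) +
          2 ^ (h + 1) * ((p + q) * (m - 2) + p * q + (1 / 2) ^ m *
            (2 * (p + q) * ((1 / 2) ^ p + (1 / 2) ^ q) + 3 * ((1 / 2) ^ p + (1 / 2) ^ q) - 6)) +
          (m + (p + q)) * (p + q) + p * q) := by
  induction hk : T.dist r x + T.dist r y using Nat.strong_induction_on generalizing x y with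
  | _ k ih =>
    wlog hle : T.dist r y ≤ T.dist r x generalizing x y with H
    · obtain ⟨m, q, p, h1, h2, h3, h4⟩ := H y x (by omega) (by omega)
      refine ⟨m, p, q, h2, h1, by rw [dist_symm T x y, h3, add_comm], ?_⟩
      rw [sqDiffSum_comm, h4]
      ring
    by_cases hxy : x = y
    · subst hxy
      -- The right side vanishes because 3(1 + 1) - 6 = 0.
      refine ⟨T.dist r x, 0, 0, rfl, rfl, by simp, ?_⟩
      simp [sqDiffSum]
      norm_num
    · have hxr : x ≠ r := by
        rintro rfl
        rw [T.dist_self, Nat.le_zero, hT.isTree.connected.dist_eq_zero_iff] at hle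
        exact hxy hle
      obtain ⟨w, hw⟩ := exists_parent hT.isTree hxr
      have hd := hw.2
      -- `x` is at least as deep as `y` and differs from it, so `x` can be moved up to its parent.
      have hy : ¬ IsBelow T r x y := by
        intro hb
        have := hT.isTree.connected.pos_dist_of_ne hxy
        unfold IsBelow at hb
        omega
      obtain ⟨m, p, q, h1, h2, h3, h4⟩ := ih _ (by omega) w y rfl
      refine ⟨m, p + 1, q, by omega, h2, ?_, ?_⟩
      · rw [dist_eq_of_not_isBelow hT.isTree hw hy, h3]
        ring
      · rw [sqDiffSum_child hT.isTree hw hy, h4, h3, hT.card_below, hT.distSum_eq x,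
          hT.distSum_eq w, hT.distSum_eq y, hT.card_eq, hd, h1, h2]
        push_cast
        ring

end PerfectTree

/-! ### Minimising over pair positions -/

section Optimization

/-- The coefficient of `n + 1` in the cost of a pair of leaders whose depths are `m + p` and
`m + q` and whose last common ancestor has depth `m`, relative to the root. -/
noncomputable def pairCoeff (m p q : ℕ) : ℝ :=
  m - 2 + p * q / (p + q) + (1 / 2) ^ m *
    (2 * ((1 / 2) ^ p + (1 / 2) ^ q) + (3 * ((1 / 2) ^ p + (1 / 2) ^ q) - 6) / (p + q))

/-- The cost of a pair of leaders relative to the single leader at the root, for `N = n + 1`. -/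
noncomputable def pairExcess (N : ℝ) (m p q : ℕ) : ℝ :=
  N * pairCoeff m p q + (m + (p + q) + p * q / (p + q))

theorem pairCoeff_comm (m p q : ℕ) : pairCoeff m p q = pairCoeff m q p := by
  simp only [pairCoeff, add_comm (q : ℝ), mul_comm (q : ℝ), add_comm ((1 / 2 : ℝ) ^ q)]

theorem pairExcess_comm (N : ℝ) (m p q : ℕ) : pairExcess N m p q = pairExcess N m q p := by
  simp only [pairExcess, pairCoeff_comm m p q, add_comm (q : ℝ), mul_comm (q : ℝ)]

theorem pairExcess_zero_two_two (N : ℝ) : pairExcess N 0 2 2 = -(9 / 8) * N + 5 := by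
  norm_num [pairExcess, pairCoeff]
  ring

theorem pairExcess_zero_one_two (N : ℝ) : pairExcess N 0 1 2 = -(13 / 12) * N + 11 / 3 := by
  norm_num [pairExcess, pairCoeff]
  ring

/-- The alternatives serve the comparison at N = 32, where the target is -36 + 5 = -31: if p + q ≥
6, the slope bound alone gives at least -36 + 6. -/
theorem le_pairCoeff_zero_of_le {p q : ℕ} (hq : q ≤ p) (hp : 1 ≤ p) :
    -(9 / 8) ≤ pairCoeff 0 p q ∧ (6 ≤ p + q ∨ (p = 2 ∧ q = 2) ∨ (p = 2 ∧ q = 1) ∨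
      -31 < 32 * pairCoeff 0 p q + (p + q + p * q / (p + q))) := by
  have hA : (0 : ℝ) < (1 / 2) ^ p := by positivity
  have hB : (0 : ℝ) < (1 / 2) ^ q := by positivity
  have hp' : (1 : ℝ) ≤ p := by exact_mod_cast hp
  by_cases hsmall : p + q < 6 ∨ (p = 3 ∧ q = 3) ∨ (p = 4 ∧ q = 3)
  · have hp7 : p ≤ 5 := by omega
    have hq7 : q ≤ 3 := by omega
    interval_cases p <;> interval_cases q <;> first | omega | norm_num [pairCoeff]
  · refine ⟨?_, Or.inl (by omega)⟩
    have hl : (0 : ℝ) < p + q := by positivity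
    have key : -(9 / 8) * (p + q : ℝ) ≤ -2 * (p + q) + p * q +
        (2 * (p + q) * ((1 / 2) ^ p + (1 / 2) ^ q) + (3 * ((1 / 2) ^ p + (1 / 2) ^ q) - 6)) := by
      rcases Nat.lt_or_ge q 3 with hq3 | hq3
      · have h6 : (6 : ℝ) ≤ p + q := by exact_mod_cast (by omega : 6 ≤ p + q)
        have hpA : (0 : ℝ) < p * (1 / 2) ^ p := by positivity
        generalize (1 / 2 : ℝ) ^ p = A at hA hpA
        interval_cases q <;> push_cast at h6 ⊢ <;> nlinarith
      · have hq3' : (3 : ℝ) ≤ q := by exact_mod_cast hq3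
        have h0 : 0 ≤ 2 * (p + q : ℝ) * ((1 / 2) ^ p + (1 / 2) ^ q) +
          3 * ((1 / 2) ^ p + (1 / 2) ^ q) := by positivity
        -- Once the positive powers are dropped this fails at (3,3) and (4,3), hence their place
        -- among the cases checked numerically.
        suffices 0 ≤ 8 * (p * q : ℝ) - 7 * p - 7 * q - 48 by linarith
        rcases Nat.lt_or_ge q 4 with hq4 | hq4
        · have hqe : q = 3 := by omega
          have hp5 : (5 : ℝ) ≤ p := by exact_mod_cast (by omega : 5 ≤ p)
          rw [hqe]
          push_cast
          linarith
        · have hq4' : (4 : ℝ) ≤ q := by exact_mod_cast hq4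
          have hp4' : (4 : ℝ) ≤ p := by exact_mod_cast (hq4.trans hq)
          nlinarith
    have e : pairCoeff 0 p q = (-2 * (p + q) + p * q +
        (2 * (p + q) * ((1 / 2) ^ p + (1 / 2) ^ q) + (3 * ((1 / 2) ^ p + (1 / 2) ^ q) - 6))) /
          (p + q) := by
      rw [pairCoeff]
      field_simp
      push_cast
      ring
    rw [e, le_div_iff₀ hl]
    exact key

theorem le_pairCoeff_zero {p q : ℕ} (hpq : 1 ≤ p + q) : -(9 / 8) ≤ pairCoeff 0 p q := by
  rcases le_total q p with h | h
  · exact (le_pairCoeff_zero_of_le h (by omega)).1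
  · rw [pairCoeff_comm]
    exact (le_pairCoeff_zero_of_le h (by omega)).1

/-- The bracket multiplying 2^(-m) does not involve m. If it is negative, damping it only helps, and
the bound at m = 0 applies; otherwise m - 2 ≥ -1 suffices. -/
theorem neg_one_le_pairCoeff {m p q : ℕ} (hm : 1 ≤ m) (hpq : 1 ≤ p + q) :
    -1 ≤ pairCoeff m p q := by
  have h0 := le_pairCoeff_zero hpq
  have hm' : (1 : ℝ) ≤ m := by exact_mod_cast hm
  have hM : (0 : ℝ) ≤ (1 / 2) ^ m := by positivity
  have hM2 : (1 / 2 : ℝ) ^ m ≤ 1 / 2 := by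
    calc (1 / 2 : ℝ) ^ m ≤ (1 / 2) ^ 1 := pow_le_pow_of_le_one (by norm_num) (by norm_num) hm
      _ = 1 / 2 := by norm_num
  have ha : (0 : ℝ) ≤ p * q / (p + q) := by positivity
  unfold pairCoeff at h0 ⊢
  rw [pow_zero, one_mul, Nat.cast_zero] at h0
  generalize (2 * ((1 / 2 : ℝ) ^ p + (1 / 2) ^ q) +
    (3 * ((1 / 2) ^ p + (1 / 2) ^ q) - 6) / (p + q)) = c at h0 ⊢
  rcases le_total 0 c with hc | hc <;> nlinarith

theorem lt_pairExcess {N : ℝ} (hN : 32 ≤ N) {m p q : ℕ} (hpq : 1 ≤ p + q)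
    (h22 : ¬ (m = 0 ∧ p = 2 ∧ q = 2)) (h12 : ¬ (m = 0 ∧ p = 1 ∧ q = 2))
    (h21 : ¬ (m = 0 ∧ p = 2 ∧ q = 1)) : -(9 / 8) * N + 5 < pairExcess N m p q := by
  -- The excess is affine in N: a slope of at least -9/8 and strict inequality at N = 32 give strict
  -- inequality for all larger N.
  suffices -(9 / 8) ≤ pairCoeff m p q ∧
      -31 < 32 * pairCoeff m p q + (m + (p + q) + p * q / (p + q)) by
    unfold pairExcess
    nlinarith [this.1, this.2]
  have ha : (0 : ℝ) ≤ p * q / (p + q) := by positivity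
  have hl : (1 : ℝ) ≤ p + q := by exact_mod_cast hpq
  rcases Nat.eq_zero_or_pos m with rfl | hm
  · wlog hle : q ≤ p generalizing p q with H
    · have := H (p := q) (q := p) (by omega) (by rwa [mul_comm, add_comm])
        (by rwa [add_comm]) (by omega) (by omega) (by omega) (by omega)
      rwa [pairCoeff_comm, mul_comm (p : ℝ), add_comm (p : ℝ)]
    obtain ⟨h1, h2⟩ := le_pairCoeff_zero_of_le hle (by omega)
    refine ⟨h1, ?_⟩
    rw [Nat.cast_zero, zero_add]
    rcases h2 with h2 | h2 | h2 | h2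
    · have : (6 : ℝ) ≤ p + q := by exact_mod_cast h2
      linarith
    · omega
    · omega
    · exact h2
  · have h1 := neg_one_le_pairCoeff hm hpq
    have hm' : (1 : ℝ) ≤ m := by exact_mod_cast hm
    exact ⟨by linarith, by linarith⟩

/-- The excess of (0,1,2) minus that of (0,2,2) is (N - 32)/24, whence the tie at N = 32. -/
theorem pairExcess_ge {N : ℝ} (hN : 32 ≤ N) {m p q : ℕ} (hpq : 1 ≤ p + q) :
    -(9 / 8) * N + 5 ≤ pairExcess N m p q ∧ (pairExcess N m p q = -(9 / 8) * N + 5 →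
      m = 0 ∧ ((p = 2 ∧ q = 2) ∨ (N = 32 ∧ ((p = 1 ∧ q = 2) ∨ (p = 2 ∧ q = 1))))) := by
  by_cases h22 : m = 0 ∧ p = 2 ∧ q = 2
  · obtain ⟨rfl, rfl, rfl⟩ := h22
    exact ⟨(pairExcess_zero_two_two N).ge, fun _ => by simp⟩
  by_cases h12 : m = 0 ∧ p = 1 ∧ q = 2
  · obtain ⟨rfl, rfl, rfl⟩ := h12
    rw [pairExcess_zero_one_two]
    exact ⟨by linarith, fun h => ⟨rfl, Or.inr ⟨by linarith, by simp⟩⟩⟩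
  by_cases h21 : m = 0 ∧ p = 2 ∧ q = 1
  · obtain ⟨rfl, rfl, rfl⟩ := h21
    rw [pairExcess_comm, pairExcess_zero_one_two]
    exact ⟨by linarith, fun h => ⟨rfl, Or.inr ⟨by linarith, by simp⟩⟩⟩
  have := lt_pairExcess hN hpq h22 h12 h21
  exact ⟨this.le, fun h => absurd h this.ne'⟩

end Optimization

/-! ### Classification of optimal leader sets -/

section Main

variable {V : Type*} [Fintype V] [DecidableEq V] {T : SimpleGraph V} [DecidableRel T.Adj] {r : V}
  {h : ℕ}

/-- Twice the optimal coherence of two noise-free leaders in the perfect binary tree of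
height `h`. -/
noncomputable def optimalCost (h : ℕ) : ℝ :=
  (h - 1) * 2 ^ (h + 1) + 2 + (-(9 / 8) * 2 ^ (h + 1) + 5)

/-- The positions of optimal pairs of leaders. -/
def IsOptimalPosition (T : SimpleGraph V) (r : V) (h : ℕ) (x y : V) : Prop :=
  (T.dist x y = 4 ∧ T.dist x r = 2 ∧ T.dist y r = 2) ∨
    (h = 4 ∧ T.dist x y = 3 ∧ T.dist x r = 1 ∧ T.dist y r = 2)

theorem thirtytwo_le_two_pow (hh : 4 ≤ h) : (32 : ℝ) ≤ 2 ^ (h + 1) := by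
  calc (32 : ℝ) = 2 ^ (4 + 1) := by norm_num
    _ ≤ 2 ^ (h + 1) := pow_le_pow_right₀ (by norm_num) (by omega)

theorem optimalCost_nonneg (hh : 4 ≤ h) : 0 ≤ optimalCost h := by
  have h1 := thirtytwo_le_two_pow hh
  have h2 : (4 : ℝ) ≤ h := by exact_mod_cast hh
  unfold optimalCost
  nlinarith

theorem IsPerfectTree.hasCoherence_pair (hT : IsPerfectTree T r 2 h) {x y : V} (hxy : x ≠ y) :
    ∃ m p q : ℕ, T.dist r x = m + p ∧ T.dist r y = m + q ∧ T.dist x y = p + q ∧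
      HasCoherence T {x, y} (ENNReal.ofReal
        (((h - 1) * 2 ^ (h + 1) + 2 + pairExcess (2 ^ (h + 1)) m p q) / 2)) := by
  obtain ⟨m, p, q, h1, h2, h3, h4⟩ := hT.exists_pair_shape x y
  refine ⟨m, p, q, h1, h2, h3, ?_⟩
  convert LeaderSelection.hasCoherence_pair hT.isTree hxy using 3
  have hl : ((p : ℝ) + q) ≠ 0 := by
    have := (hT.isTree.connected.pos_dist_of_ne hxy).ne'
    rw [h3] at this
    exact_mod_cast this
  rw [h4, h3, pairExcess, pairCoeff]
  push_cast
  field_simp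
  ring

theorem IsPerfectTree.hasCoherence_of_isOptimalPosition (hT : IsPerfectTree T r 2 h) {x y : V}
    (hpos : IsOptimalPosition T r h x y) :
    HasCoherence T {x, y} (ENNReal.ofReal (optimalCost h / 2)) := by
  have hxy : x ≠ y := by
    rintro rfl
    rcases hpos with hp | hp <;> simp at hp
  obtain ⟨m, p, q, h1, h2, h3, hc⟩ := hT.hasCoherence_pair hxy
  unfold IsOptimalPosition at hpos
  rw [dist_symm T x r, dist_symm T y r] at hpos
  convert hc using 3
  rw [optimalCost]
  congr 1
  rcases hpos with ⟨e1, e2, e3⟩ | ⟨e0, e1, e2, e3⟩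
  · obtain ⟨rfl, rfl, rfl⟩ : m = 0 ∧ p = 2 ∧ q = 2 := by omega
    rw [pairExcess_zero_two_two]
  · obtain ⟨rfl, rfl, rfl⟩ : m = 0 ∧ p = 1 ∧ q = 2 := by omega
    rw [pairExcess_zero_one_two, e0]
    norm_num

theorem IsPerfectTree.coherence_cases (hT : IsPerfectTree T r 2 h) (hh : 4 ≤ h) {S : Finset V}
    (hS : S.card ≤ 2) : HasCoherence T S ⊤ ∨ ∃ F : ℝ, HasCoherence T S (ENNReal.ofReal (F / 2)) ∧
      optimalCost h ≤ F ∧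
        (F = optimalCost h → ∃ x y, S = {x, y} ∧ IsOptimalPosition T r h x y) := by
  have hN := thirtytwo_le_two_pow hh
  have : S.card = 0 ∨ S.card = 1 ∨ S.card = 2 := by omega
  rcases this with h0 | h1 | h2
  · rw [Finset.card_eq_zero] at h0
    have : Nonempty V := ⟨r⟩
    exact Or.inl (h0 ▸ hasCoherence_empty T)
  · obtain ⟨x, rfl⟩ := Finset.card_eq_one.1 h1
    refine Or.inr ⟨_, hasCoherence_singleton hT.isTree x, ?_⟩
    suffices optimalCost h < distSum T x from ⟨this.le, fun e => absurd e this.ne'⟩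
    rw [hT.distSum_eq, optimalCost]
    -- A single leader never beats the root, whose cost already exceeds the optimum by 9N/8 - 5 > 0.
    have : (0 : ℝ) ≤ T.dist r x - 2 + 2 * (1 / 2) ^ T.dist r x := by
      rcases Nat.lt_or_ge (T.dist r x) 2 with hlt | hge
      · interval_cases T.dist r x <;> norm_num
      · have h2 : (2 : ℝ) ≤ T.dist r x := by exact_mod_cast hge
        have h3 : (0 : ℝ) < (1 / 2) ^ T.dist r x := by positivity
        linarith
    have h4 := mul_nonneg (by positivity : (0 : ℝ) ≤ 2 ^ (h + 1)) this
    have h5 : (0 : ℝ) ≤ T.dist r x := by positivity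
    linarith
  · obtain ⟨x, y, hxy, rfl⟩ := Finset.card_eq_two.1 h2
    obtain ⟨m, p, q, e1, e2, e3, hc⟩ := hT.hasCoherence_pair hxy
    have hl := hT.isTree.connected.pos_dist_of_ne hxy
    obtain ⟨hge, heq⟩ := pairExcess_ge hN (m := m) (p := p) (q := q) (by omega)
    refine Or.inr ⟨_, hc, ?_, ?_⟩
    · unfold optimalCost
      linarith
    · intro e
      unfold optimalCost at e
      obtain ⟨rfl, hcase⟩ := heq (by linarith)
      rcases hcase with ⟨rfl, rfl⟩ | ⟨h32, hcase⟩
      · refine ⟨x, y, rfl, Or.inl ⟨e3, ?_, ?_⟩⟩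
        · rw [dist_symm, e1]
        · rw [dist_symm, e2]
      · have h4 : h = 4 := by
          have h5 : (2 : ℝ) ^ (h + 1) = 2 ^ 5 := by rw [h32]; norm_num
          have := pow_right_injective₀ (by norm_num : (0 : ℝ) < 2) (by norm_num) h5
          omega
        rcases hcase with ⟨rfl, rfl⟩ | ⟨rfl, rfl⟩
        · refine ⟨x, y, rfl, Or.inr ⟨h4, e3, ?_, ?_⟩⟩
          · rw [dist_symm, e1]
          · rw [dist_symm, e2]
        · refine ⟨y, x, Finset.pair_comm x y, Or.inr ⟨h4, ?_, ?_, ?_⟩⟩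
          · rw [dist_symm, e3]
          · rw [dist_symm, e2]
          · rw [dist_symm, e1]

/-- Take grandchildren of the root through its two different children. -/
theorem IsPerfectTree.exists_isOptimalPosition {V : Type*} {T : SimpleGraph V} {r : V}
    {h : ℕ} (hT : IsPerfectTree T r 2 h) (hh : 4 ≤ h) :
    ∃ x y, IsOptimalPosition T r h x y := by
  obtain ⟨c, c', hne, hch⟩ := hT.exists_children (u := r) (by simp; omega)
  have hc : c ∈ children T r r := by simp [hch]
  have hc' : c' ∈ children T r r := by simp [hch]
  have hd : T.dist r c = 1 := by simpa using hc.2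
  have hd' : T.dist r c' = 1 := by simpa using hc'.2
  obtain ⟨x, _, -, hxc⟩ := hT.exists_children (u := c) (by omega)
  obtain ⟨y, _, -, hyc⟩ := hT.exists_children (u := c') (by omega)
  have hx : x ∈ children T r c := by simp [hxc]
  have hy : y ∈ children T r c' := by simp [hyc]
  have h1 : ¬ IsBelow T r c c' := fun hb =>
    hne (children_eq_of_isBelow hT.isTree hc hc' hb (isBelow_self r c'))
  have h2 : ¬ IsBelow T r x c' := fun hb =>
    h1 ((isBelow_iff_children hT.isTree).2 (Or.inr ⟨x, hx, hb⟩))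
  have h3 : ¬ IsBelow T r y x := fun hb =>
    hne (children_eq_of_isBelow hT.isTree hc hc'
      ((isBelow_iff_children hT.isTree).2 (Or.inr ⟨x, hx, isBelow_self r x⟩))
      ((isBelow_iff_children hT.isTree).2 (Or.inr ⟨y, hy, hb⟩)))
  have e1 := dist_eq_of_not_isBelow hT.isTree hc h1
  have e2 := dist_eq_of_not_isBelow hT.isTree hx h2
  have e3 := dist_eq_of_not_isBelow hT.isTree hy h3
  have e4 := hx.2
  have e5 := hy.2
  refine ⟨x, y, Or.inl ⟨?_, ?_, ?_⟩⟩
  · rw [dist_symm T x y, e3, dist_symm T c' x, e2, e1, hd']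
  · rw [dist_symm, e4, hd]
  · rw [dist_symm, e5, hd']

theorem IsPerfectTree.isOptimalLeaderSet_iff (hT : IsPerfectTree T r 2 h) (hh : 4 ≤ h)
    (S : Finset V) :
    IsOptimalLeaderSet T 2 S ↔ ∃ x y, S = {x, y} ∧ IsOptimalPosition T r h x y := by
  constructor
  · rintro ⟨hcard, R, hR, hmin⟩
    obtain ⟨x, y, hxy⟩ := hT.exists_isOptimalPosition hh
    obtain ⟨R', hR', hle⟩ := hmin {x, y} Finset.card_le_two
    rw [hR'.unique (hT.hasCoherence_of_isOptimalPosition hxy)] at hle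
    rcases hT.coherence_cases hh hcard with htop | ⟨F, hF, hge, heq⟩
    · rw [hR.unique htop] at hle
      exact absurd (top_le_iff.1 hle) ENNReal.ofReal_ne_top
    -- `ENNReal.ofReal` truncates at 0, so nonnegativity of the optimal cost is needed to recover
    -- the real inequality.
    · rw [hR.unique hF, ENNReal.ofReal_le_ofReal_iff
        (div_nonneg (optimalCost_nonneg hh) two_pos.le)] at hle
      exact heq (by linarith)
  · rintro ⟨x, y, rfl, hxy⟩
    refine ⟨Finset.card_le_two, _, hT.hasCoherence_of_isOptimalPosition hxy, fun S' hS' => ?_⟩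
    rcases hT.coherence_cases hh hS' with htop | ⟨F, hF, hge, -⟩
    · exact ⟨⊤, htop, le_top⟩
    · exact ⟨_, hF, ENNReal.ofReal_le_ofReal (by linarith)⟩

end Main

theorem IsPerfectTree.optimalCost_div_two {V : Type*} [Fintype V] {T : SimpleGraph V} {r : V} {h : ℕ}
    (hT : IsPerfectTree T r 2 h) :
    optimalCost h / 2 = ((Fintype.card V : ℝ) + 1) / 2 *
      (Real.logb 2 ((Fintype.card V : ℝ) + 1) - 25 / 8) + 7 / 2 := by
  rw [hT.card_eq, sub_add_cancel, Real.logb_pow, Real.logb_self_eq_one (by norm_num), optimalCost]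
  push_cast
  ring

end LeaderSelection

theorem mainTheorem6 {V : Type*} [Fintype V] [DecidableEq V]
    (T : SimpleGraph V) [DecidableRel T.Adj] (r : V) (h : ℕ) (hh : 4 ≤ h)
    (hT : LeaderSelection.IsPerfectTree T r 2 h) :
    (∃ S : Finset V, LeaderSelection.IsOptimalLeaderSet T 2 S) ∧
    ∀ S : Finset V,
      (LeaderSelection.IsOptimalLeaderSet T 2 S ↔
        ∃ x y : V, S = {x, y} ∧
          ((T.dist x y = 4 ∧ T.dist x r = 2 ∧ T.dist y r = 2) ∨
            (h = 4 ∧ T.dist x y = 3 ∧ T.dist x r = 1 ∧ T.dist y r = 2))) ∧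
      (LeaderSelection.IsOptimalLeaderSet T 2 S →
        LeaderSelection.HasCoherence T S
          (ENNReal.ofReal (((Fintype.card V : ℝ) + 1) / 2 *
            (Real.logb 2 ((Fintype.card V : ℝ) + 1) - 25 / 8) + 7 / 2))) := by
  refine ⟨?_, fun S => ⟨hT.isOptimalLeaderSet_iff hh S, fun hS => ?_⟩⟩
  · obtain ⟨x, y, hxy⟩ := hT.exists_isOptimalPosition hh
    exact ⟨{x, y}, (hT.isOptimalLeaderSet_iff hh _).2 ⟨x, y, rfl, hxy⟩⟩
  · obtain ⟨x, y, rfl, hxy⟩ := (hT.isOptimalLeaderSet_iff hh S).1 hS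
    rw [← hT.optimalCost_div_two]
    exact hT.hasCoherence_of_isOptimalPosition hxy
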